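/- **Theorem (Floating-point robustness certificate).** *Floating-point arithmetic.* Fix a binary floating-point format with precision $p\ge 2$, smallest positive subnormal number $2^{e_{\min}}$ and exponent bound $e_{\max}\ge e_{\min}+p$, with gradual underflow and round-to-nearest, ties-to-even. Let $F_{\max}=(2^p-1)2^{e_{\max}-p}$ be its largest finite number, $u=2^{-p}$ its unit roundoff and $a_{\mathrm{mul}}=2^{e_{\min}-1}$. An operation returns the rounded exact result and overflows if that rounded result exceeds $F_{\max}$ in magnitude. Put $\gamma_n=(1+u)^n-1$, $\kappa_n=\gamma_n+u(1+\gamma_n)$, $A_n=(1+\gamma_n)\,n\,a_{\mathrm{mul}}$, and $A'_n=(1+\gamma_{n-1})\,n\,a_{\mathrm{mul}}$ (with $A'_0=0$). *Network.* Consider a dense network with $L\ge 1$ layers, $W_\ell\in\mathbb R^{m_\ell\times n_\ell}$, $b_\ell\in\mathbb R^{m_\ell}$, $m_\ell=n_{\ell+1}$, $z_0(x)=x\in\mathbb R^{n_1}$, $z_\ell=\varphi_\ell(W_\ell z_{\ell-1}+b_\ell)$ and output $N(x)=z_L(x)$. Each $\varphi_\ell$ is a scalar function applied entrywise, with $\varphi_\ell(0)=0$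 and Lipschitz constant $L(\varphi_\ell)\ge 0$, and $\varphi_L$ is the identity. In the floating-point execution, $\hat z_0=x$, $\hat a_\ell=\mathrm{fl}(\mathrm{fl}(W_\ell\hat z_{\ell-1})+b_\ell)$, and $\hat z_\ell$ is the floating-point evaluation of $\varphi_\ell$ at $\hat a_\ell$; the output is $\hat N(x)=\hat z_L$. Every product and every addition is rounded, and the products of each dot product are added up in an arbitrary fixed order. The activations are FP-exact: on finite floating-point numbers the floating-point evaluation of $\varphi_\ell$ is a finite floating-point number equal to the exact value of $\varphi_\ell$. Write $m_{j,i}(x)=N(x)_i-N(x)_j$ and $\hat m_{j,i}(x)=\hat N(x)_i-\hat N(x)_j$. *Bounds.* $\|\cdot\|_2$ is the Euclidean or spectral norm, and absolute values of matrices and vectors are entrywise. For $x\in\mathbb R^{n_1}$ and $\varepsilon\ge0$ put $r_0=\|x\|_2+\varepsilon$, $D_0=0$ and, for $1\le\ell\le L-1$, $$r_\ell=L(\varphi_\ell)\bigl(\|W_\ell\|_2r_{\ell-1}+\|b_\ell\|_2\bigr),\qquad D_\ell=\alpha_\ell D_{\ell-1}+\beta_\ell(r_{\ell-1}),$$ $$\alpha_\ell=L(\varphi_\ell)\bigl(\|W_\ell\|_2+\kappa_{n_\ell}\||W_\ell|\|_2\bigr),$$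 $$\beta_\ell(r)=L(\varphi_\ell)\bigl(\kappa_{n_\ell}\||W_\ell|\|_2\,r+u\|b_\ell\|_2+(1+u)A_{n_\ell}\sqrt{m_\ell}\bigr).$$ With $w_{\ell,i}$ denoting row $i$ of $W_\ell$ and $b_{L,i}$ the entries of $b_L$, put $$\alpha_L^{(j,i)}=\|w_{L,i}-w_{L,j}\|_2+\kappa_{n_L}\||w_{L,i}|+|w_{L,j}|\|_2,$$ $$\beta_L^{(j,i)}(r)=\kappa_{n_L}\||w_{L,i}|+|w_{L,j}|\|_2\,r+u(|b_{L,i}|+|b_{L,j}|)+2(1+u)A_{n_L},$$ and $E^{(j,i)}(x,\varepsilon)=\alpha_L^{(j,i)}D_{L-1}+\beta_L^{(j,i)}(r_{L-1})$. *Claim.* Let $x\in\mathbb R^{n_1}$, $\varepsilon>0$ and $i^*=\mathrm{ArgMax}(N(x))$. Suppose: (i) with $r_0=\|x\|_2+\varepsilon$, for every layer $\ell=1,\dots,L$ the entries of $W_\ell$ and $b_\ell$ are finite floating-point numbers, and $$\max_i\|w_{\ell,i}\|_2\,(r_{\ell-1}+D_{\ell-1})(1+\gamma_{n_\ell})+A'_{n_\ell}+\|b_\ell\|_\infty<F_{\max},\qquad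 \max_i\|w_{\ell,i}\|_\infty\,(r_{\ell-1}+D_{\ell-1})<F_{\max};$$ (ii) for every $j\ne i^*$ there is a constant $L_{j,i^*}\ge0$ with $|m_{j,i^*}(x_1)-m_{j,i^*}(x_2)|\le L_{j,i^*}\|x_1-x_2\|_2$ for all $x_1,x_2\in\mathbb R^{n_1}$; (iii) for every $j\neq i^*$, with $E_{\mathrm{ctr}}=E^{(j,i^*)}(x,0)$ and $E_{\mathrm{ball}}=E^{(j,i^*)}(x,\varepsilon)$, $$\hat m_{j,i^*}(x)-L_{j,i^*}\,\varepsilon-(E_{\mathrm{ctr}}+E_{\mathrm{ball}})>0.$$ Then for every $x'$ with $\|x'-x\|_2\le\varepsilon$ the floating-point execution at $x'$ does not overflow, $\hat m_{j,i^*}(x')>0$ for every $j\ne i^*$, and hence $\mathrm{ArgMax}(\hat N(x'))=\mathrm{ArgMax}(\hat N(x))=i^*$. -/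

import Mathlib

namespace FPRobust

noncomputable section

/-! ### Floating-point arithmetic -/

/-- A binary floating-point format with gradual underflow: `prec` is the precision in bits,
`2 ^ emin` is the smallest positive subnormal number and `2 ^ emax` is the first power of two that
is too large to be represented.  For the IEEE-754 formats `emin = 3 - emax - prec`, with
`(prec, emax)` equal to `(11, 16)` for float16, `(24, 128)` for float32, `(53, 1024)` for float64;
bfloat16 is `(8, 128)`. -/
structure Format where
  prec : ℕ
  emin : ℤ
  emax : ℤ
  one_lt_prec : 1 < prec
  emin_add_prec_le : emin + prec ≤ emax

/-- Rounding of a real number to a nearest integer, ties to the even integer. -/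
def roundTiesEven (t : ℝ) : ℤ :=
  if Int.fract t < 1 / 2 then ⌊t⌋
  else if 1 / 2 < Int.fract t then ⌊t⌋ + 1
  else if Even ⌊t⌋ then ⌊t⌋ else ⌊t⌋ + 1

namespace Format

variable (F : Format)

/-- The largest finite floating-point number. -/
def Fmax : ℝ := (2 ^ F.prec - 1) * (2 : ℝ) ^ (F.emax - F.prec)

/-- The unit roundoff `u`. -/
def u : ℝ := (2 : ℝ) ^ (-(F.prec : ℤ))

/-- The absolute roundoff error `a_mul` of a multiplication with a subnormal result: half of the
smallest positive subnormal number. -/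
def amul : ℝ := (2 : ℝ) ^ (F.emin - 1)

/-- `t` is (the value of) a finite floating-point number. -/
def Representable (t : ℝ) : Prop :=
  (∃ m e : ℤ, |m| < 2 ^ F.prec ∧ F.emin ≤ e ∧ t = m * (2 : ℝ) ^ e) ∧ |t| ≤ F.Fmax

/-- The exponent of the last place at the magnitude of `t`: `prec` significant bits are kept, but
no bit below `2 ^ emin`. -/
def ulpExp (t : ℝ) : ℤ := max (Int.log 2 |t| + 1 - F.prec) F.emin

/-- Round to nearest, ties to even, with gradual underflow, before the range check. -/
def rnd (t : ℝ) : ℝ := roundTiesEven (t / (2 : ℝ) ^ F.ulpExp t) * (2 : ℝ) ^ F.ulpExp t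

/-- The floating-point result of an operation whose exact real result is `t`; the value `none` means
that the operation overflows. -/
def fl (t : ℝ) : Option ℝ := if |F.rnd t| ≤ F.Fmax then some (F.rnd t) else none

/-- `γ_n = (1 + u) ^ n - 1`. -/
def gamma (n : ℕ) : ℝ := (1 + F.u) ^ n - 1

/-- `κ_n = γ_n + u (1 + γ_n)`. -/
def kappa (n : ℕ) : ℝ := F.gamma n + F.u * (1 + F.gamma n)

/-- The bound `(1 + γ_n) n a_mul` for the absolute error of a dot product of length `n`. -/
def adot (n : ℕ) : ℝ := (1 + F.gamma n) * n * F.amul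

/-- The variant `(1 + γ_{n-1}) n a_mul` used in the overflow check (it is `0` for `n = 0`). -/
def adotFwd (n : ℕ) : ℝ := (1 + F.gamma (n - 1)) * n * F.amul

end Format

/-- An order of evaluation for a sum of terms indexed by `ι`: a binary tree of additions, which may
also contain additions of the constant zero (for instance the initial value of an accumulator). -/
inductive SumTree (ι : Type) : Type
  | zero : SumTree ι
  | leaf : ι → SumTree ι
  | node : SumTree ι → SumTree ι → SumTree ι

/-- The terms that are added up. -/
def SumTree.leaves {ι : Type} : SumTree ι → List ι
  | zero => []
  | leaf i => [i]
  | node l r => l.leaves ++ r.leaves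

/-- Floating-point evaluation of the dot product of `w` and `z`: every product and every addition is
rounded, and the additions are carried out in the given order.  The result is `none` if one of the
operations overflows. -/
def fpDot (F : Format) {n : ℕ} (w z : Fin n → ℝ) : SumTree (Fin n) → Option ℝ
  | .zero => some 0
  | .leaf k => F.fl (w k * z k)
  | .node l r => (fpDot F w z l).bind fun s => (fpDot F w z r).bind fun t => F.fl (s + t)

open Classical in
/-- A vector of results, or `none` if one of its entries is `none`. -/
def collect {m : ℕ} (v : Fin m → Option ℝ) : Option (Fin m → ℝ) :=
  if h : ∀ i, (v i).isSome then some fun i => (v i).get (h i) else none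

/-! ### Norms and ArgMax -/

/-- The Euclidean norm of a vector. -/
def l2 {n : ℕ} (v : Fin n → ℝ) : ℝ := ‖WithLp.toLp 2 v‖

/-- The maximum norm of a vector. -/
def linf {n : ℕ} (v : Fin n → ℝ) : ℝ := ‖v‖

open scoped Matrix.Norms.L2Operator in
/-- The spectral norm of a matrix: its operator norm with respect to Euclidean norms. -/
def specNorm {m n : ℕ} (A : Matrix (Fin m) (Fin n) ℝ) : ℝ := ‖A‖

/-- The entrywise absolute value of a matrix. -/
def absMat {m n : ℕ} (A : Matrix (Fin m) (Fin n) ℝ) : Matrix (Fin m) (Fin n) ℝ := A.map fun t => |t|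

/-- The set of indices of the maximal components of `y`. -/
def argMax {m : ℕ} (y : Fin m → ℝ) : Set (Fin m) := {i | ∀ j, y j ≤ y i}

/-! ### Networks -/

/-- A dense feed-forward network with `hidden` hidden layers followed by one output layer.  Layers
are numbered from `0`, so the layers are `0, …, hidden`; layer `ℓ` maps vectors of length `dim ℓ` to
vectors of length `dim (ℓ + 1)`.  Data with larger indices is never used.
The activation functions are zero-preserving scalar functions, applied to each entry, and `lip ℓ`
is a Lipschitz constant of `act ℓ`. -/
structure Network where
  hidden : ℕ
  dim : ℕ → ℕ
  W : (ℓ : ℕ) → Matrix (Fin (dim (ℓ + 1))) (Fin (dim ℓ)) ℝ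
  b : (ℓ : ℕ) → Fin (dim (ℓ + 1)) → ℝ
  act : ℕ → ℝ → ℝ
  lip : ℕ → ℝ
  act_zero : ∀ ℓ ≤ hidden, act ℓ 0 = 0
  lip_nonneg : ∀ ℓ ≤ hidden, 0 ≤ lip ℓ
  act_lipschitz : ∀ ℓ ≤ hidden, ∀ s t, |act ℓ s - act ℓ t| ≤ lip ℓ * |s - t|

namespace Network

variable (N : Network)

/-- The space of inputs. -/
abbrev Input : Type := EuclideanSpace ℝ (Fin (N.dim 0))

/-- The index type of the outputs, that is, the set of classes. -/
abbrev Class : Type := Fin (N.dim (N.hidden + 1))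

/-- The exact activations: `z x ℓ` is the input of layer `ℓ`, which is the output of layer `ℓ - 1` if
`ℓ > 0` and the network input `x` if `ℓ = 0`. -/
def z (x : N.Input) : (ℓ : ℕ) → Fin (N.dim ℓ) → ℝ
  | 0 => fun k => x k
  | ℓ + 1 => fun i => N.act ℓ ((N.W ℓ).mulVec (z x ℓ) i + N.b ℓ i)

/-- The output of the network in real arithmetic. -/
def eval (x : N.Input) : N.Class → ℝ := N.z x (N.hidden + 1)

/-- The margin `m_{j,i}(x) = y_i - y_j` in real arithmetic. -/
def margin (j i : N.Class) (x : N.Input) : ℝ := N.eval x i - N.eval x j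

/-- The deterministic radii, with `r_0 = ‖x‖ + ε`; `radius x ε ℓ` belongs to the input of
layer `ℓ`. -/
def radius (x : N.Input) (ε : ℝ) : ℕ → ℝ
  | 0 => ‖x‖ + ε
  | ℓ + 1 => N.lip ℓ * (specNorm (N.W ℓ) * radius x ε ℓ + l2 (N.b ℓ))

variable (F : Format)

/-- The amplification factor of layer `ℓ`. -/
def alpha (ℓ : ℕ) : ℝ :=
  N.lip ℓ * (specNorm (N.W ℓ) + F.kappa (N.dim ℓ) * specNorm (absMat (N.W ℓ)))

/-- The fresh rounding error of layer `ℓ`. -/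
def beta (ℓ : ℕ) (r : ℝ) : ℝ :=
  N.lip ℓ * (F.kappa (N.dim ℓ) * specNorm (absMat (N.W ℓ)) * r + F.u * l2 (N.b ℓ)
    + (1 + F.u) * F.adot (N.dim ℓ) * √(N.dim (ℓ + 1)))

/-- The cumulative deviation bounds; `dev F x ε ℓ` belongs to the input of layer `ℓ`. -/
def dev (x : N.Input) (ε : ℝ) : ℕ → ℝ
  | 0 => 0
  | ℓ + 1 => N.alpha F ℓ * dev x ε ℓ + N.beta F ℓ (N.radius x ε ℓ)

/-- The conditions for the absence of overflow in layer `ℓ`: weights and biases are finite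
floating-point numbers, and the two layer-wide inequalities hold. -/
structure OverflowFreeAt (x : N.Input) (ε : ℝ) (ℓ : ℕ) : Prop where
  weight_repr : ∀ i k, F.Representable (N.W ℓ i k)
  bias_repr : ∀ i, F.Representable (N.b ℓ i)
  sum_lt : (⨆ i, l2 (N.W ℓ i)) * (N.radius x ε ℓ + N.dev F x ε ℓ) * (1 + F.gamma (N.dim ℓ))
    + F.adotFwd (N.dim ℓ) + linf (N.b ℓ) < F.Fmax
  prod_lt : (⨆ i, linf (N.W ℓ i)) * (N.radius x ε ℓ + N.dev F x ε ℓ) < F.Fmax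

/-- The Euclidean norm of `|W_i| + |W_j|` for two rows of the output layer. -/
def absRowSum (j i : N.Class) : ℝ := l2 fun k => |N.W N.hidden i k| + |N.W N.hidden j k|

/-- The pairwise amplification factor of the output layer. -/
def alphaOut (j i : N.Class) : ℝ :=
  l2 (fun k => N.W N.hidden i k - N.W N.hidden j k)
    + F.kappa (N.dim N.hidden) * N.absRowSum j i

/-- The pairwise fresh rounding error of the output layer. -/
def betaOut (j i : N.Class) (r : ℝ) : ℝ :=
  F.kappa (N.dim N.hidden) * N.absRowSum j i * r
    + F.u * (|N.b N.hidden i| + |N.b N.hidden j|) + 2 * (1 + F.u) * F.adot (N.dim N.hidden)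

/-- The bound for the deviation of a margin on the ball of radius `ε` around `x`.  It is
`E_ball` for the given `ε`, and `E_ctr` for `ε = 0`. -/
def marginErr (x : N.Input) (ε : ℝ) (j i : N.Class) : ℝ :=
  N.alphaOut F j i * N.dev F x ε N.hidden + N.betaOut F j i (N.radius x ε N.hidden)

/-- The choices that fix the floating-point execution of a network: for every row of every layer an
order in which the products of the dot product are added up, and for every layer the function
`actFP ℓ` that the floating-point implementation of the activation function computes on finite
floating-point numbers. -/
structure FPImpl where
  order : (ℓ : ℕ) → Fin (N.dim (ℓ + 1)) → SumTree (Fin (N.dim ℓ))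
  order_perm : ∀ ℓ ≤ N.hidden, ∀ i, (order ℓ i).leaves.Perm (List.finRange (N.dim ℓ))
  actFP : ℕ → ℝ → ℝ

namespace FPImpl

variable {N} (I : N.FPImpl)

/-- The activations are FP-exact: on finite floating-point numbers, the floating-point evaluation of
the activation function is a finite floating-point number and agrees with the real one. -/
def FPExact : Prop :=
  ∀ ℓ ≤ N.hidden, ∀ t, F.Representable t →
    F.Representable (I.actFP ℓ t) ∧ I.actFP ℓ t = N.act ℓ t

/-- The floating-point execution of layer `ℓ` on the vector `v`: the rounded matrix-vector product,
the rounded addition of the bias, and then the activation function. -/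
def fpLayer (ℓ : ℕ) (v : Fin (N.dim ℓ) → ℝ) : Option (Fin (N.dim (ℓ + 1)) → ℝ) :=
  collect fun i => (fpDot F (N.W ℓ i) v (I.order ℓ i)).bind fun s =>
    (F.fl (s + N.b ℓ i)).map (I.actFP ℓ)

/-- The floating-point activations: `fpZ F x ℓ` is the input of layer `ℓ` in the floating-point
execution, or `none` if an operation in an earlier layer overflows. -/
def fpZ (x : N.Input) : (ℓ : ℕ) → Option (Fin (N.dim ℓ) → ℝ)
  | 0 => some fun k => x k
  | ℓ + 1 => (fpZ x ℓ).bind (I.fpLayer F ℓ)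

/-- The output of the floating-point execution, or `none` if an operation overflows. -/
def fpEval (x : N.Input) : Option (N.Class → ℝ) := I.fpZ F x (N.hidden + 1)

end FPImpl

end Network

end

end FPRobust

/-!
A floating-point margin can differ from the exact one by at most the certified deviation, on the
whole ball and, with `ε = 0`, at the centre.  Hence for `x'` in the ball
`m̂(x') ≥ m(x') - E_ball ≥ m(x) - L ε - E_ball ≥ m̂(x) - L ε - (E_ctr + E_ball) > 0`.

The deviation bound rests on two facts about a single rounding.  In general
`|rnd t - t| ≤ u |t| + a_mul` (`abs_rnd_sub_le`), but for `t` on the grid `2 ^ emin ℤ`, in particular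
for a sum of floating-point numbers, the absolute term is absent (`abs_rnd_sub_le_of_onGrid`), since
gradual underflow makes small sums exact.  An induction on the summation tree gives the error of a
dot product (`abs_fpDot_sub_le`); additions of the constant zero cost nothing because they are exact.
Adding the bias gives the error of a row (`fpRow_error`), and an induction on the layers propagates
it through the network (`fpZ_error`).

These error bounds hold for every execution that yields a result.  That there is one is shown
separately: rounding does not cross `Fmax` (`abs_rnd_le_Fmax`), and the first overflow condition
bounds every partial sum of a row together with its bias (`fpRow_exists`, `fpZ_exists`).
-/

namespace FPRobust

/-! ### Rounding to an integer -/

theorem roundTiesEven_intCast (m : ℤ) : roundTiesEven (m : ℝ) = m := by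
  simp [roundTiesEven]

theorem floor_le_roundTiesEven (t : ℝ) : ⌊t⌋ ≤ roundTiesEven t := by
  unfold roundTiesEven; split_ifs <;> omega

theorem roundTiesEven_le_floor_add_one (t : ℝ) : roundTiesEven t ≤ ⌊t⌋ + 1 := by
  unfold roundTiesEven; split_ifs <;> omega

theorem le_roundTiesEven {m : ℤ} {t : ℝ} (h : (m : ℝ) ≤ t) : m ≤ roundTiesEven t :=
  (Int.le_floor.2 h).trans (floor_le_roundTiesEven t)

theorem roundTiesEven_le {m : ℤ} {t : ℝ} (h : t ≤ m) : roundTiesEven t ≤ m := by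
  rcases h.eq_or_lt with rfl | h
  · exact (roundTiesEven_intCast m).le
  · have := Int.floor_lt.2 h
    have := roundTiesEven_le_floor_add_one t
    omega

theorem abs_roundTiesEven_le {m : ℤ} {t : ℝ} (h : |t| ≤ m) : |roundTiesEven t| ≤ m := by
  rw [abs_le] at h ⊢
  exact ⟨le_roundTiesEven (by push_cast; exact h.1), roundTiesEven_le h.2⟩

theorem abs_roundTiesEven_sub_le (t : ℝ) : |(roundTiesEven t : ℝ) - t| ≤ 1 / 2 := by
  have h := Int.floor_add_fract t
  have h0 := Int.fract_nonneg t
  have h1 := Int.fract_lt_one t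
  rw [abs_le]
  unfold roundTiesEven
  split_ifs <;> push_cast <;> constructor <;> linarith

namespace Format

variable (F : Format)

/-! ### Rounding to a floating-point number -/

theorem u_pos : 0 < F.u := zpow_pos two_pos _

theorem amul_pos : 0 < F.amul := zpow_pos two_pos _

theorem one_le_one_add_u : 1 ≤ 1 + F.u := by linarith [F.u_pos]

theorem gamma_nonneg (n : ℕ) : 0 ≤ F.gamma n :=
  sub_nonneg.2 (one_le_pow₀ F.one_le_one_add_u)

theorem gamma_mono : Monotone F.gamma := fun _ _ h =>
  sub_le_sub_right (pow_le_pow_right₀ F.one_le_one_add_u h) 1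

theorem kappa_nonneg (n : ℕ) : 0 ≤ F.kappa n :=
  add_nonneg (F.gamma_nonneg n)
    (mul_nonneg F.u_pos.le (add_nonneg zero_le_one (F.gamma_nonneg n)))

theorem adot_nonneg (n : ℕ) : 0 ≤ F.adot n :=
  mul_nonneg (mul_nonneg (add_nonneg zero_le_one (F.gamma_nonneg n)) n.cast_nonneg) F.amul_pos.le

theorem adotFwd_le_adot (n : ℕ) : F.adotFwd n ≤ F.adot n := by
  unfold adotFwd adot
  gcongr
  · exact F.amul_pos.le
  · exact F.gamma_mono (n.sub_le 1)

/-- The integer multiples of the smallest positive subnormal number. -/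
def OnGrid (t : ℝ) : Prop := ∃ m : ℤ, t = m * (2 : ℝ) ^ F.emin

theorem mul_zpow_eq (m : ℤ) {e e' : ℤ} (h : e' ≤ e) :
    ∃ k : ℤ, (m : ℝ) * (2 : ℝ) ^ e = k * (2 : ℝ) ^ e' := by
  obtain ⟨d, rfl⟩ := Int.le.dest h
  refine ⟨m * 2 ^ d, ?_⟩
  rw [zpow_add₀ two_ne_zero, zpow_natCast]
  push_cast
  ring

variable {F}

theorem Representable.onGrid {t : ℝ} (h : F.Representable t) : F.OnGrid t := by
  obtain ⟨⟨m, e, -, he, rfl⟩, -⟩ := h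
  exact mul_zpow_eq m he

theorem OnGrid.add {s t : ℝ} (hs : F.OnGrid s) (ht : F.OnGrid t) : F.OnGrid (s + t) := by
  obtain ⟨m, rfl⟩ := hs
  obtain ⟨k, rfl⟩ := ht
  exact ⟨m + k, by push_cast; ring⟩

variable (F)

theorem emin_le_ulpExp (t : ℝ) : F.emin ≤ F.ulpExp t := le_max_right _ _

/-- The spacing at `t` is at most `2 ^ e` if `t` has at most `prec` bits above `2 ^ e`. -/
theorem ulpExp_le {t : ℝ} {e : ℤ} (he : F.emin ≤ e) (h : |t| < (2 : ℝ) ^ (e + F.prec)) (ht : t ≠ 0) :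
    F.ulpExp t ≤ e := by
  have hl : Int.log 2 |t| < e + F.prec :=
    (Int.lt_zpow_iff_log_lt one_lt_two (abs_pos.2 ht)).1 (by exact_mod_cast h)
  unfold ulpExp
  omega

/-- Numbers with a `prec`-bit significand are fixed by rounding. -/
theorem rnd_eq_self {m e : ℤ} (hm : |m| < 2 ^ F.prec) (he : F.emin ≤ e) :
    F.rnd (m * (2 : ℝ) ^ e) = m * (2 : ℝ) ^ e := by
  set t : ℝ := m * (2 : ℝ) ^ e with htdef
  by_cases ht : t = 0
  · have : roundTiesEven 0 = 0 := by exact_mod_cast roundTiesEven_intCast 0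
    simp [rnd, ht, this]
  have hlt : |t| < (2 : ℝ) ^ (e + F.prec) := by
    rw [htdef, abs_mul, abs_of_pos (zpow_pos two_pos e : (0 : ℝ) < 2 ^ e), zpow_add₀ two_ne_zero,
      zpow_natCast, mul_comm]
    gcongr
    exact_mod_cast hm
  obtain ⟨k, hk⟩ := mul_zpow_eq m (F.ulpExp_le he hlt ht)
  have hp : (2 : ℝ) ^ F.ulpExp t ≠ 0 := (zpow_pos two_pos _).ne'
  rw [rnd, show t / (2 : ℝ) ^ F.ulpExp t = k by rw [div_eq_iff hp]; exact hk,
    roundTiesEven_intCast, ← hk]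

theorem abs_rnd_sub_le_half_ulp (t : ℝ) : |F.rnd t - t| ≤ (2 : ℝ) ^ F.ulpExp t / 2 := by
  have hp : (0 : ℝ) < (2 : ℝ) ^ F.ulpExp t := zpow_pos two_pos _
  have h := abs_roundTiesEven_sub_le (t / (2 : ℝ) ^ F.ulpExp t)
  have h' : F.rnd t - t = (roundTiesEven (t / (2 : ℝ) ^ F.ulpExp t) - t / (2 : ℝ) ^ F.ulpExp t)
      * (2 : ℝ) ^ F.ulpExp t := by
    rw [rnd]; field_simp
  rw [h', abs_mul, abs_of_pos hp]
  nlinarith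

/-- In the normal range the error of rounding is relative. -/
theorem abs_rnd_sub_le_of_emin_lt {t : ℝ} (ht : t ≠ 0) (h : F.emin < F.ulpExp t) :
    |F.rnd t - t| ≤ F.u * |t| := by
  have hlog : F.ulpExp t = Int.log 2 |t| + 1 - F.prec := by
    unfold ulpExp at h ⊢
    omega
  have hle : (2 : ℝ) ^ Int.log 2 |t| ≤ |t| := by
    exact_mod_cast Int.zpow_log_le_self (R := ℝ) one_lt_two (abs_pos.2 ht)
  refine (F.abs_rnd_sub_le_half_ulp t).trans ?_
  rw [hlog, show Int.log 2 |t| + 1 - (F.prec : ℤ) = -(F.prec : ℤ) + Int.log 2 |t| + 1 by ring,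
    zpow_add₀ two_ne_zero, zpow_add₀ two_ne_zero, zpow_one, mul_div_cancel_right₀ _ two_ne_zero]
  exact mul_le_mul_of_nonneg_left hle F.u_pos.le

theorem rnd_zero : F.rnd 0 = 0 := by
  simpa using F.rnd_eq_self (m := 0) (by simp) le_rfl

theorem abs_rnd_sub_le (t : ℝ) : |F.rnd t - t| ≤ F.u * |t| + F.amul := by
  have hu := mul_nonneg F.u_pos.le (abs_nonneg t)
  by_cases ht : t = 0
  · simp [ht, rnd_zero, F.amul_pos.le]
  rcases (F.emin_le_ulpExp t).eq_or_lt with h | h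
  · have := F.abs_rnd_sub_le_half_ulp t
    rw [← h, div_eq_mul_inv, ← zpow_sub_one₀ two_ne_zero] at this
    exact this.trans (le_add_of_nonneg_left hu)
  · exact (F.abs_rnd_sub_le_of_emin_lt ht h).trans (le_add_of_nonneg_right F.amul_pos.le)

/-- There is no underflow error on the grid: in the subnormal range its points are rounded exactly. -/
theorem abs_rnd_sub_le_of_onGrid {t : ℝ} (hg : F.OnGrid t) : |F.rnd t - t| ≤ F.u * |t| := by
  by_cases ht : t = 0
  · simp [ht, rnd_zero]
  rcases (F.emin_le_ulpExp t).eq_or_lt with h | h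
  · obtain ⟨m, hm⟩ := hg
    have hp : (2 : ℝ) ^ F.emin ≠ 0 := (zpow_pos two_pos _).ne'
    have : F.rnd t = t := by
      rw [rnd, ← h, show t / (2 : ℝ) ^ F.emin = m by rw [div_eq_iff hp]; exact hm,
        roundTiesEven_intCast, ← hm]
    rw [this, sub_self, abs_zero]
    exact mul_nonneg F.u_pos.le (abs_nonneg t)
  · exact F.abs_rnd_sub_le_of_emin_lt ht h

/-- Rounding does not leave the range of finite numbers, since `Fmax` is a floating-point number. -/
theorem abs_rnd_le_Fmax {t : ℝ} (h : |t| ≤ F.Fmax) : |F.rnd t| ≤ F.Fmax := by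
  have hF : F.Fmax = ((2 ^ F.prec - 1 : ℤ) : ℝ) * (2 : ℝ) ^ (F.emax - F.prec) := by
    simp [Fmax]
  by_cases ht : t = 0
  · simpa [ht, rnd_zero] using h
  have hlt : |t| < (2 : ℝ) ^ (F.emax - F.prec + F.prec) := by
    refine h.trans_lt ?_
    rw [hF, zpow_add₀ two_ne_zero, zpow_natCast, mul_comm]
    gcongr
    push_cast
    linarith
  have he : F.ulpExp t ≤ F.emax - F.prec :=
    F.ulpExp_le (by linarith [F.emin_add_prec_le]) hlt ht
  have hp : (0 : ℝ) < (2 : ℝ) ^ F.ulpExp t := zpow_pos two_pos _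
  obtain ⟨k, hk⟩ := mul_zpow_eq (2 ^ F.prec - 1) he
  rw [rnd, abs_mul, abs_of_pos hp, hF, hk]
  gcongr
  have : |t / (2 : ℝ) ^ F.ulpExp t| ≤ k := by
    rw [abs_div, abs_of_pos hp, div_le_iff₀ hp, ← hk, ← hF]
    exact h
  exact_mod_cast abs_roundTiesEven_le this

/-- A rounded number has a `prec`-bit significand.  When rounding carries to `2 ^ prec`, the
significand is halved. -/
theorem exists_rnd_eq (t : ℝ) :
    ∃ m e : ℤ, |m| < 2 ^ F.prec ∧ F.emin ≤ e ∧ F.rnd t = m * (2 : ℝ) ^ e := by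
  have hp : (0 : ℝ) < (2 : ℝ) ^ F.ulpExp t := zpow_pos two_pos _
  have hlt : |t| ≤ (2 : ℝ) ^ (F.ulpExp t + F.prec) := by
    have h1 : |t| < (2 : ℝ) ^ (Int.log 2 |t| + 1) := by
      exact_mod_cast Int.lt_zpow_succ_log_self (R := ℝ) one_lt_two |t|
    refine h1.le.trans (zpow_le_zpow_right₀ one_le_two ?_)
    unfold ulpExp
    omega
  have hle : |roundTiesEven (t / (2 : ℝ) ^ F.ulpExp t)| ≤ 2 ^ F.prec := by
    refine abs_roundTiesEven_le ?_
    rw [abs_div, abs_of_pos hp, div_le_iff₀ hp]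
    rw [add_comm, zpow_add₀ two_ne_zero, zpow_natCast] at hlt
    exact_mod_cast hlt
  have h2 : (2 : ℤ) ^ F.prec = 2 * 2 ^ (F.prec - 1) := by
    rw [← pow_succ', Nat.sub_add_cancel F.one_lt_prec.le]
  have hpos : (0 : ℤ) < 2 ^ (F.prec - 1) := by positivity
  rcases hle.lt_or_eq with h | h
  · exact ⟨_, _, h, F.emin_le_ulpExp t, rfl⟩
  · have hz : (2 : ℝ) ^ (F.ulpExp t + 1) = 2 * 2 ^ F.ulpExp t := by
      rw [zpow_add₀ two_ne_zero, zpow_one, mul_comm]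
    have hc : ((2 : ℝ) ^ F.prec) = 2 * 2 ^ (F.prec - 1) := by exact_mod_cast h2
    have he := F.emin_le_ulpExp t
    rcases (abs_eq (by positivity)).1 h with h | h
    · refine ⟨2 ^ (F.prec - 1), F.ulpExp t + 1, ?_, by omega, ?_⟩
      · rw [abs_of_pos hpos, h2]; linarith
      · rw [rnd, h, hz]; push_cast; rw [hc]; ring
    · refine ⟨-2 ^ (F.prec - 1), F.ulpExp t + 1, ?_, by omega, ?_⟩
      · rw [abs_neg, abs_of_pos hpos, h2]; linarith
      · rw [rnd, h, hz]; push_cast; rw [hc]; ring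

variable {F}

theorem fl_eq_some {t s : ℝ} (h : F.fl t = some s) : F.rnd t = s ∧ F.Representable s := by
  unfold fl at h
  split_ifs at h with hle
  obtain rfl := Option.some.inj h
  exact ⟨rfl, F.exists_rnd_eq t, hle⟩

theorem fl_of_abs_rnd_le {t : ℝ} (h : |F.rnd t| ≤ F.Fmax) : F.fl t = some (F.rnd t) := if_pos h

theorem fl_of_representable {t : ℝ} (h : F.Representable t) : F.fl t = some t := by
  obtain ⟨⟨m, e, hm, he, rfl⟩, hle⟩ := h
  rw [fl_of_abs_rnd_le] <;> rw [F.rnd_eq_self hm he]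
  exact hle

variable (F)

theorem representable_zero : F.Representable 0 := by
  refine ⟨⟨0, F.emin, by simp, le_rfl, by simp⟩, ?_⟩
  rw [abs_zero, Fmax]
  exact mul_nonneg (sub_nonneg.2 (one_le_pow₀ one_le_two)) (zpow_pos two_pos _).le

end Format

/-! ### Dot products -/

section Dot

variable {F : Format} {n : ℕ} {w z : Fin n → ℝ}

/-- The bound for the absolute value of a computed sum of `k` products, where `S` is the sum of
the absolute values of the exact products. -/
noncomputable def dotBound (F : Format) (k : ℕ) (S : ℝ) : ℝ :=
  (1 + F.u) ^ k * S + (1 + F.u) ^ (k - 1) * (k * F.amul)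

theorem dotBound_mono_right {k : ℕ} {S S' : ℝ} (h : S ≤ S') : dotBound F k S ≤ dotBound F k S' :=
  add_le_add_left (mul_le_mul_of_nonneg_left h (pow_nonneg (by linarith [F.u_pos]) k)) _

/-- One more rounding of two non-empty partial sums is paid for by the larger exponent. -/
theorem one_add_u_mul_dotBound_add_le {k l : ℕ} (hk : k ≠ 0) (hl : l ≠ 0) {S T : ℝ} (hS : 0 ≤ S)
    (hT : 0 ≤ T) :
    (1 + F.u) * (dotBound F k S + dotBound F l T) ≤ dotBound F (k + l) (S + T) := by
  have h1 := F.one_le_one_add_u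
  have ha := F.amul_pos.le
  have key : ∀ k l : ℕ, k ≠ 0 → l ≠ 0 → ∀ S : ℝ, 0 ≤ S → (1 + F.u) * dotBound F k S ≤
      (1 + F.u) ^ (k + l) * S + (1 + F.u) ^ (k + l - 1) * (k * F.amul) := by
    intro k l hk hl S hS
    rw [dotBound, mul_add, ← mul_assoc, ← mul_assoc, ← pow_succ', ← pow_succ']
    gcongr <;> first | exact h1 | omega
  have h2 := key k l hk hl S hS
  have h3 := key l k hl hk T hT
  rw [add_comm l k] at h3
  rw [mul_add]
  refine (add_le_add h2 h3).trans_eq ?_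
  rw [dotBound]
  push_cast
  ring

theorem abs_list_sum_le {ι : Type} (f : ι → ℝ) (l : List ι) :
    |(l.map f).sum| ≤ (l.map fun k => |f k|).sum := by
  induction l with
  | nil => simp
  | cons a l ih =>
    simp only [List.map_cons, List.sum_cons]
    exact (abs_add_le _ _).trans (by gcongr)

theorem list_sum_abs_nonneg {ι : Type} (f : ι → ℝ) (l : List ι) :
    0 ≤ (l.map fun k => |f k|).sum :=
  (abs_nonneg _).trans (abs_list_sum_le f l)

theorem fpDot_node_eq_some {l r : SumTree (Fin n)} {s : ℝ} (h : fpDot F w z (.node l r) = some s) :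
    ∃ a b, fpDot F w z l = some a ∧ fpDot F w z r = some b ∧ F.fl (a + b) = some s := by
  simpa [fpDot, Option.bind_eq_some_iff] using h

theorem fpDot_representable {T : SumTree (Fin n)} {s : ℝ} (h : fpDot F w z T = some s) :
    F.Representable s := by
  cases T with
  | zero => obtain rfl := Option.some.inj h; exact F.representable_zero
  | leaf k => exact (Format.fl_eq_some h).2
  | node l r =>
    obtain ⟨a, b, -, -, h⟩ := fpDot_node_eq_some h
    exact (Format.fl_eq_some h).2

theorem fpDot_of_leaves_eq_nil {T : SumTree (Fin n)} (h : T.leaves = []) :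
    fpDot F w z T = some 0 := by
  induction T with
  | zero => rfl
  | leaf k => simp [SumTree.leaves] at h
  | node l r hl hr =>
    obtain ⟨h1, h2⟩ := List.append_eq_nil_iff.1 h
    simp [fpDot, hl h1, hr h2, Format.fl_of_representable F.representable_zero]

/-- An empty left summand has no effect, because adding zero is exact. -/
theorem fpDot_node_of_left_nil {l r : SumTree (Fin n)} (h : l.leaves = []) :
    fpDot F w z (.node l r) = fpDot F w z r := by
  rw [fpDot, fpDot_of_leaves_eq_nil h]
  cases hr : fpDot F w z r with
  | none => rfl
  | some b => simp [Format.fl_of_representable (fpDot_representable hr)]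

theorem fpDot_node_of_right_nil {l r : SumTree (Fin n)} (h : r.leaves = []) :
    fpDot F w z (.node l r) = fpDot F w z l := by
  rw [fpDot, fpDot_of_leaves_eq_nil h]
  cases hl : fpDot F w z l with
  | none => rfl
  | some b => simp [Format.fl_of_representable (fpDot_representable hl)]

theorem abs_fpDot_sub_le {T : SumTree (Fin n)} {s : ℝ} (h : fpDot F w z T = some s) :
    |s - (T.leaves.map fun k => w k * z k).sum| ≤
      dotBound F T.leaves.length (T.leaves.map fun k => |w k * z k|).sum
        - (T.leaves.map fun k => |w k * z k|).sum := by
  induction T generalizing s with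
  | zero =>
    obtain rfl := Option.some.inj h
    simp [SumTree.leaves, dotBound]
  | leaf k =>
    obtain ⟨rfl, -⟩ := Format.fl_eq_some h
    have := F.abs_rnd_sub_le (w k * z k)
    simp only [SumTree.leaves, dotBound, List.map_cons, List.map_nil, List.sum_cons, List.sum_nil,
      List.length_singleton]
    simp only [add_zero, pow_one, Nat.sub_self, pow_zero, Nat.cast_one, one_mul]
    linarith
  | node l r hl hr =>
    by_cases hl0 : l.leaves = []
    · rw [fpDot_node_of_left_nil hl0] at h
      simpa [SumTree.leaves, hl0] using hr h
    by_cases hr0 : r.leaves = []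
    · rw [fpDot_node_of_right_nil hr0] at h
      simpa [SumTree.leaves, hr0] using hl h
    obtain ⟨a, b, ha, hb, h⟩ := fpDot_node_eq_some h
    obtain ⟨rfl, -⟩ := Format.fl_eq_some h
    have hrnd := F.abs_rnd_sub_le_of_onGrid
      ((fpDot_representable ha).onGrid.add (fpDot_representable hb).onGrid)
    have hb1 := one_add_u_mul_dotBound_add_le (F := F) (mt List.length_eq_zero_iff.1 hl0)
      (mt List.length_eq_zero_iff.1 hr0) (list_sum_abs_nonneg (fun k => w k * z k) l.leaves)
      (list_sum_abs_nonneg (fun k => w k * z k) r.leaves)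
    have ea := hl ha
    have eb := hr hb
    have sa := abs_list_sum_le (fun k => w k * z k) l.leaves
    have sb := abs_list_sum_le (fun k => w k * z k) r.leaves
    simp only [SumTree.leaves, List.map_append, List.sum_append, List.length_append]
    set s1 := (l.leaves.map fun k => w k * z k).sum
    set s2 := (r.leaves.map fun k => w k * z k).sum
    set S1 := (l.leaves.map fun k => |w k * z k|).sum
    set S2 := (r.leaves.map fun k => |w k * z k|).sum
    have hab : |a + b| ≤ |a - s1| + |b - s2| + |s1| + |s2| := by
      calc |a + b| = |((a - s1) + (b - s2)) + (s1 + s2)| := by ring_nf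
        _ ≤ |(a - s1) + (b - s2)| + |s1 + s2| := abs_add_le _ _
        _ ≤ _ := by linarith [abs_add_le (a - s1) (b - s2), abs_add_le s1 s2]
    have htri : |F.rnd (a + b) - (s1 + s2)| ≤ |F.rnd (a + b) - (a + b)| + (|a - s1| + |b - s2|) := by
      calc |F.rnd (a + b) - (s1 + s2)|
          = |(F.rnd (a + b) - (a + b)) + ((a - s1) + (b - s2))| := by ring_nf
        _ ≤ |F.rnd (a + b) - (a + b)| + |(a - s1) + (b - s2)| := abs_add_le _ _
        _ ≤ _ := by linarith [abs_add_le (a - s1) (b - s2)]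
    have hu : F.u * |a + b| ≤ F.u * (dotBound F l.leaves.length S1 +
        dotBound F r.leaves.length S2) :=
      mul_le_mul_of_nonneg_left (by linarith) F.u_pos.le
    linarith

theorem abs_fpDot_le {T : SumTree (Fin n)} {s : ℝ} (h : fpDot F w z T = some s) :
    |s| ≤ dotBound F T.leaves.length (T.leaves.map fun k => |w k * z k|).sum := by
  have h1 := abs_fpDot_sub_le h
  have h2 := abs_list_sum_le (fun k => w k * z k) T.leaves
  have h3 := abs_sub_abs_le_abs_sub s (T.leaves.map fun k => w k * z k).sum
  linarith

/-- A dot product does not overflow if the bound for its absolute value is at most `Fmax`: the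
same then holds for all its partial sums. -/
theorem fpDot_exists {T : SumTree (Fin n)}
    (h : dotBound F T.leaves.length (T.leaves.map fun k => |w k * z k|).sum ≤ F.Fmax) :
    ∃ s, fpDot F w z T = some s := by
  induction T with
  | zero => exact ⟨0, rfl⟩
  | leaf k =>
    refine ⟨_, Format.fl_of_abs_rnd_le (le_trans ?_ h)⟩
    have h1 := F.abs_rnd_sub_le (w k * z k)
    have h2 := abs_sub_abs_le_abs_sub (F.rnd (w k * z k)) (w k * z k)
    simp only [SumTree.leaves, dotBound, List.map_cons, List.map_nil, List.sum_cons, List.sum_nil,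
      List.length_singleton]
    simp only [add_zero, pow_one, Nat.sub_self, pow_zero, Nat.cast_one, one_mul]
    linarith
  | node l r hl hr =>
    by_cases hl0 : l.leaves = []
    · rw [fpDot_node_of_left_nil hl0]
      exact hr (by simpa [SumTree.leaves, hl0] using h)
    by_cases hr0 : r.leaves = []
    · rw [fpDot_node_of_right_nil hr0]
      exact hl (by simpa [SumTree.leaves, hr0] using h)
    have hS1 := list_sum_abs_nonneg (fun k => w k * z k) l.leaves
    have hS2 := list_sum_abs_nonneg (fun k => w k * z k) r.leaves
    have hb1 := one_add_u_mul_dotBound_add_le (F := F) (mt List.length_eq_zero_iff.1 hl0)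
      (mt List.length_eq_zero_iff.1 hr0) hS1 hS2
    simp only [SumTree.leaves, List.map_append, List.sum_append, List.length_append] at h
    set S1 := (l.leaves.map fun k => |w k * z k|).sum
    set S2 := (r.leaves.map fun k => |w k * z k|).sum
    have h1 := F.one_le_one_add_u
    have ha := F.amul_pos.le
    have p1 : 0 ≤ dotBound F l.leaves.length S1 := by unfold dotBound; positivity
    have p2 : 0 ≤ dotBound F r.leaves.length S2 := by unfold dotBound; positivity
    have pu := mul_nonneg F.u_pos.le (add_nonneg p1 p2)
    obtain ⟨a, hla⟩ := hl (by linarith)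
    obtain ⟨b, hrb⟩ := hr (by linarith)
    have ea := abs_fpDot_le hla
    have eb := abs_fpDot_le hrb
    have hab : |a + b| ≤ F.Fmax := by linarith [abs_add_le a b]
    refine ⟨F.rnd (a + b), ?_⟩
    rw [fpDot, hla, hrb]
    exact Format.fl_of_abs_rnd_le (F.abs_rnd_le_Fmax hab)

end Dot

/-! ### Euclidean norms -/

section Norms

variable {m n : ℕ}

theorem l2_eq_sqrt (v : Fin n → ℝ) : l2 v = √(∑ i, v i ^ 2) := by
  simp [l2, EuclideanSpace.norm_eq]

theorem l2_nonneg (v : Fin n → ℝ) : 0 ≤ l2 v := norm_nonneg _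

theorem l2_mono {v w : Fin n → ℝ} (h : ∀ i, |v i| ≤ w i) : l2 v ≤ l2 w := by
  rw [l2_eq_sqrt, l2_eq_sqrt]
  refine Real.sqrt_le_sqrt (Finset.sum_le_sum fun i _ => ?_)
  exact sq_le_sq' (by linarith [neg_abs_le (v i), h i]) ((le_abs_self _).trans (h i))

theorem l2_abs (v : Fin n → ℝ) : l2 (fun i => |v i|) = l2 v := by
  simp [l2_eq_sqrt]

theorem l2_add_le (v w : Fin n → ℝ) : l2 (fun i => v i + w i) ≤ l2 v + l2 w :=
  norm_add_le (WithLp.toLp 2 v) (WithLp.toLp 2 w)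

theorem l2_const_mul {c : ℝ} (hc : 0 ≤ c) (v : Fin n → ℝ) : l2 (fun i => c * v i) = c * l2 v := by
  have := norm_smul c (WithLp.toLp 2 v)
  rwa [Real.norm_of_nonneg hc] at this

theorem l2_const {c : ℝ} (hc : 0 ≤ c) : l2 (fun _ : Fin n => c) = c * √n := by
  rw [l2_eq_sqrt]
  simp only [Finset.sum_const, Finset.card_univ, Fintype.card_fin, nsmul_eq_mul]
  rw [Real.sqrt_mul n.cast_nonneg, Real.sqrt_sq hc, mul_comm]

theorem l2_mulVec_le (A : Matrix (Fin m) (Fin n) ℝ) (v : Fin n → ℝ) :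
    l2 (A.mulVec v) ≤ specNorm A * l2 v :=
  Matrix.l2_opNorm_mulVec A (WithLp.toLp 2 v)

theorem specNorm_nonneg (A : Matrix (Fin m) (Fin n) ℝ) : 0 ≤ specNorm A := by
  open scoped Matrix.Norms.L2Operator in exact norm_nonneg A

theorem sum_abs_mul_le (w v : Fin n → ℝ) : ∑ k, |w k * v k| ≤ l2 w * l2 v := by
  rw [l2_eq_sqrt, l2_eq_sqrt]
  have := Real.sum_mul_le_sqrt_mul_sqrt Finset.univ (fun k => |w k|) (fun k => |v k|)
  simpa [abs_mul] using this

end Norms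

/-! ### Rows of a layer -/

section Row

variable {F : Format} {n : ℕ} {w v : Fin n → ℝ} {T : SumTree (Fin n)} {b : ℝ}

theorem list_sum_eq_of_perm (hT : T.leaves.Perm (List.finRange n)) (f : Fin n → ℝ) :
    (T.leaves.map f).sum = ∑ k, f k := by
  rw [(hT.map f).sum_eq, Fin.sum_univ_def]

theorem length_eq_of_perm (hT : T.leaves.Perm (List.finRange n)) : T.leaves.length = n := by
  simpa using hT.length_eq

theorem dotBound_eq (F : Format) (n : ℕ) (S : ℝ) :
    dotBound F n S = (1 + F.gamma n) * S + F.adotFwd n := by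
  simp only [dotBound, Format.adotFwd, Format.gamma]
  ring

/-- The error of an entry of the rounded affine map. -/
theorem fpRow_error (hT : T.leaves.Perm (List.finRange n)) (hb : F.Representable b) {s t : ℝ}
    (hs : fpDot F w v T = some s) (ht : F.fl (s + b) = some t) :
    |t - (∑ k, w k * v k + b)| ≤
      F.kappa n * ∑ k, |w k * v k| + F.u * |b| + (1 + F.u) * F.adot n := by
  have h1 := abs_fpDot_sub_le hs
  rw [list_sum_eq_of_perm hT, list_sum_eq_of_perm hT, length_eq_of_perm hT, dotBound_eq] at h1
  obtain ⟨rfl, -⟩ := Format.fl_eq_some ht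
  have h2 := F.abs_rnd_sub_le_of_onGrid ((fpDot_representable hs).onGrid.add hb.onGrid)
  have h3 := F.adotFwd_le_adot n
  have h4 := Finset.abs_sum_le_sum_abs (fun k => w k * v k) Finset.univ
  set S := ∑ k, |w k * v k|
  set p := ∑ k, w k * v k
  have h5 : |s + b| ≤ |s - p| + S + |b| := by
    calc |s + b| = |(s - p) + p + b| := by ring_nf
      _ ≤ |s - p| + |p| + |b| := abs_add_three _ _ _
      _ ≤ _ := by linarith
  have h6 : |F.rnd (s + b) - (p + b)| ≤ |F.rnd (s + b) - (s + b)| + |s - p| := by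
    calc |F.rnd (s + b) - (p + b)| = |(F.rnd (s + b) - (s + b)) + (s - p)| := by ring_nf
      _ ≤ _ := abs_add_le _ _
  have h7 : |s - p| ≤ F.gamma n * S + F.adot n := by linarith
  have h8 : F.u * |s + b| ≤ F.u * (F.gamma n * S + F.adot n + S + |b|) :=
    mul_le_mul_of_nonneg_left (by linarith) F.u_pos.le
  rw [Format.kappa]
  linarith

theorem fpRow_exists (hT : T.leaves.Perm (List.finRange n))
    (h : l2 w * l2 v * (1 + F.gamma n) + F.adotFwd n + |b| ≤ F.Fmax) :
    ∃ s t, fpDot F w v T = some s ∧ F.fl (s + b) = some t := by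
  have hB : dotBound F T.leaves.length (T.leaves.map fun k => |w k * v k|).sum + |b| ≤ F.Fmax := by
    rw [list_sum_eq_of_perm hT, length_eq_of_perm hT]
    have := dotBound_mono_right (F := F) (k := n) (sum_abs_mul_le w v)
    rw [dotBound_eq F n (_ * _)] at this
    linarith
  obtain ⟨s, hs⟩ := fpDot_exists (w := w) (z := v) (by linarith [abs_nonneg b])
  refine ⟨s, _, hs, Format.fl_of_abs_rnd_le (F.abs_rnd_le_Fmax ?_)⟩
  linarith [abs_add_le s b, abs_fpDot_le hs]

theorem collect_eq_some {m : ℕ} {f : Fin m → Option ℝ} {y : Fin m → ℝ} :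
    collect f = some y ↔ ∀ i, f i = some (y i) := by
  unfold collect
  split_ifs with h
  · rw [Option.some_inj, funext_iff]
    exact forall_congr' fun i => by rw [← Option.some_inj, Option.some_get]
  · simp only [false_iff]
    exact fun hf => h fun i => by simp [hf i]

end Row

/-! ### Propagation through the network -/

namespace Network

variable {N : Network} {F : Format} {I : N.FPImpl} {x x' : N.Input} {ε : ℝ}

theorem fpLayer_eq_some {ℓ : ℕ} {v : Fin (N.dim ℓ) → ℝ} {y : Fin (N.dim (ℓ + 1)) → ℝ}
    (h : I.fpLayer F ℓ v = some y) (i : Fin (N.dim (ℓ + 1))) :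
    ∃ s t, fpDot F (N.W ℓ i) v (I.order ℓ i) = some s ∧ F.fl (s + N.b ℓ i) = some t ∧
      I.actFP ℓ t = y i := by
  have := collect_eq_some.1 h i
  simpa [Option.bind_eq_some_iff] using this

/-- An entry of a computed layer is the exact activation function at a pre-activation with a small
error. -/
theorem fpLayer_entry (hexact : I.FPExact F) {ℓ : ℕ} (hℓ : ℓ ≤ N.hidden)
    (hb : ∀ i, F.Representable (N.b ℓ i)) {v : Fin (N.dim ℓ) → ℝ} {y : Fin (N.dim (ℓ + 1)) → ℝ}
    (h : I.fpLayer F ℓ v = some y) (i : Fin (N.dim (ℓ + 1))) :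
    ∃ t, y i = N.act ℓ t ∧ |t - ((N.W ℓ).mulVec v i + N.b ℓ i)| ≤
      F.kappa (N.dim ℓ) * ∑ k, |N.W ℓ i k * v k| + F.u * |N.b ℓ i|
        + (1 + F.u) * F.adot (N.dim ℓ) := by
  obtain ⟨s, t, hs, ht, hy⟩ := fpLayer_eq_some h i
  exact ⟨t, hy ▸ (hexact ℓ hℓ t (Format.fl_eq_some ht).2).2,
    fpRow_error (I.order_perm ℓ hℓ i) (hb i) hs ht⟩

theorem l2_z_le (hx : ‖x' - x‖ ≤ ε) {ℓ : ℕ} (hℓ : ℓ ≤ N.hidden) :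
    l2 (N.z x' ℓ) ≤ N.radius x ε ℓ := by
  induction ℓ with
  | zero =>
    change ‖x'‖ ≤ ‖x‖ + ε
    linarith [norm_le_norm_add_norm_sub' x' x]
  | succ ℓ ih =>
    have hℓ' : ℓ ≤ N.hidden := by omega
    have hlip := N.lip_nonneg ℓ hℓ'
    calc l2 (N.z x' (ℓ + 1))
        ≤ l2 fun i => N.lip ℓ * |(N.W ℓ).mulVec (N.z x' ℓ) i + N.b ℓ i| := by
          refine l2_mono fun i => ?_
          have := N.act_lipschitz ℓ hℓ' ((N.W ℓ).mulVec (N.z x' ℓ) i + N.b ℓ i) 0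
          rwa [N.act_zero ℓ hℓ', sub_zero, sub_zero] at this
      _ ≤ N.lip ℓ * (specNorm (N.W ℓ) * N.radius x ε ℓ + l2 (N.b ℓ)) := by
          rw [l2_const_mul hlip, l2_abs]
          refine mul_le_mul_of_nonneg_left ((l2_add_le _ _).trans ?_) hlip
          gcongr
          exact (l2_mulVec_le _ _).trans
            (mul_le_mul_of_nonneg_left (ih hℓ') (specNorm_nonneg _))

theorem l2_le_add_sub {n : ℕ} (v z : Fin n → ℝ) : l2 v ≤ l2 z + l2 fun k => v k - z k := by
  simpa using l2_add_le z fun k => v k - z k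

/-- Whenever the first layers do not overflow, their result deviates from the exact activations by
at most `dev`. -/
theorem fpZ_error (hexact : I.FPExact F) (hb : ∀ ℓ ≤ N.hidden, ∀ i, F.Representable (N.b ℓ i))
    (hx : ‖x' - x‖ ≤ ε) {ℓ : ℕ} (hℓ : ℓ ≤ N.hidden) {v : Fin (N.dim ℓ) → ℝ}
    (hv : I.fpZ F x' ℓ = some v) :
    l2 (fun k => v k - N.z x' ℓ k) ≤ N.dev F x ε ℓ := by
  induction ℓ with
  | zero =>
    obtain rfl := Option.some.inj hv
    simp [Network.z, dev, l2_eq_sqrt]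
  | succ ℓ ih =>
    have hℓ' : ℓ ≤ N.hidden := by omega
    have hlip := N.lip_nonneg ℓ hℓ'
    obtain ⟨v₀, hv₀, hlayer⟩ := Option.bind_eq_some_iff.1 hv
    have hD := ih hℓ' hv₀
    have hr := l2_z_le hx hℓ'
    have hκ := F.kappa_nonneg (N.dim ℓ)
    have hu := F.u_pos.le
    have hA := F.adot_nonneg (N.dim ℓ)
    set z₀ := N.z x' ℓ
    have hv0r : l2 v₀ ≤ N.radius x ε ℓ + N.dev F x ε ℓ := (l2_le_add_sub v₀ z₀).trans (by gcongr)
    have hent : ∀ i, |v i - N.z x' (ℓ + 1) i| ≤ N.lip ℓ *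
        (((|(N.W ℓ).mulVec (fun k => v₀ k - z₀ k) i|
          + F.kappa (N.dim ℓ) * (absMat (N.W ℓ)).mulVec (fun k => |v₀ k|) i)
          + F.u * |N.b ℓ i|) + (1 + F.u) * F.adot (N.dim ℓ)) := by
      intro i
      obtain ⟨t, ht, herr⟩ := fpLayer_entry hexact hℓ' (hb ℓ hℓ') hlayer i
      have hsum : ∑ k, |N.W ℓ i k * v₀ k| = (absMat (N.W ℓ)).mulVec (fun k => |v₀ k|) i := by
        simp [Matrix.mulVec, dotProduct, absMat, abs_mul]
      rw [hsum] at herr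
      have hsub : (N.W ℓ).mulVec (fun k => v₀ k - z₀ k) i
          = (N.W ℓ).mulVec v₀ i - (N.W ℓ).mulVec z₀ i :=
        congrFun (Matrix.mulVec_sub (N.W ℓ) v₀ z₀) i
      rw [ht]
      refine (N.act_lipschitz ℓ hℓ' _ _).trans (mul_le_mul_of_nonneg_left ?_ hlip)
      rw [hsub]
      have := abs_add_le (t - ((N.W ℓ).mulVec v₀ i + N.b ℓ i))
        ((N.W ℓ).mulVec v₀ i - (N.W ℓ).mulVec z₀ i)
      rw [show t - ((N.W ℓ).mulVec v₀ i + N.b ℓ i) + ((N.W ℓ).mulVec v₀ i - (N.W ℓ).mulVec z₀ i)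
        = t - ((N.W ℓ).mulVec z₀ i + N.b ℓ i) by ring] at this
      linarith
    have h1 : l2 ((N.W ℓ).mulVec fun k => v₀ k - z₀ k) ≤ specNorm (N.W ℓ) * N.dev F x ε ℓ :=
      (l2_mulVec_le _ _).trans (mul_le_mul_of_nonneg_left hD (specNorm_nonneg _))
    have h2 : l2 ((absMat (N.W ℓ)).mulVec fun k => |v₀ k|) ≤
        specNorm (absMat (N.W ℓ)) * (N.radius x ε ℓ + N.dev F x ε ℓ) := by
      refine (l2_mulVec_le _ _).trans (mul_le_mul_of_nonneg_left ?_ (specNorm_nonneg _))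
      rwa [l2_abs]
    calc _ ≤ _ := l2_mono hent
      _ = _ := l2_const_mul hlip _
      _ ≤ N.lip ℓ * (((specNorm (N.W ℓ) * N.dev F x ε ℓ + F.kappa (N.dim ℓ) *
            (specNorm (absMat (N.W ℓ)) * (N.radius x ε ℓ + N.dev F x ε ℓ)))
            + F.u * l2 (N.b ℓ)) + (1 + F.u) * F.adot (N.dim ℓ) * √(N.dim (ℓ + 1))) := by
        refine mul_le_mul_of_nonneg_left ?_ hlip
        refine (l2_add_le _ _).trans (add_le_add ((l2_add_le _ _).trans (add_le_add
          ((l2_add_le _ _).trans (add_le_add ?_ ?_)) ?_)) ?_)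
        · rwa [l2_abs]
        · rw [l2_const_mul hκ]
          exact mul_le_mul_of_nonneg_left h2 hκ
        · rw [l2_const_mul hu, l2_abs]
        · rw [l2_const (by positivity)]
      _ = N.dev F x ε (ℓ + 1) := by
        rw [dev, alpha, beta]
        ring

/-- The overflow conditions of a layer suffice for every input within the certified bounds. -/
theorem fpLayer_exists {ℓ : ℕ} (hℓ : ℓ ≤ N.hidden) (h : N.OverflowFreeAt F x ε ℓ)
    {v : Fin (N.dim ℓ) → ℝ} (hv : l2 v ≤ N.radius x ε ℓ + N.dev F x ε ℓ) :
    ∃ y, I.fpLayer F ℓ v = some y := by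
  have key : ∀ i, ∃ s t, fpDot F (N.W ℓ i) v (I.order ℓ i) = some s ∧
      F.fl (s + N.b ℓ i) = some t := by
    intro i
    refine fpRow_exists (I.order_perm ℓ hℓ i) (le_trans ?_ h.sum_lt.le)
    have hγ := F.gamma_nonneg (N.dim ℓ)
    have hw : l2 (N.W ℓ i) ≤ ⨆ i, l2 (N.W ℓ i) :=
      le_ciSup (f := fun i => l2 (N.W ℓ i)) (Set.finite_range _).bddAbove i
    have hbi : |N.b ℓ i| ≤ linf (N.b ℓ) := norm_le_pi_norm (N.b ℓ) i
    have := l2_nonneg v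
    have := (l2_nonneg (N.W ℓ i)).trans hw
    gcongr
  choose s t hs ht using key
  refine ⟨fun i => I.actFP ℓ (t i), collect_eq_some.2 fun i => ?_⟩
  simp [hs i, ht i]

theorem fpZ_exists (hexact : I.FPExact F) (hov : ∀ ℓ ≤ N.hidden, N.OverflowFreeAt F x ε ℓ)
    (hx : ‖x' - x‖ ≤ ε) {ℓ : ℕ} (hℓ : ℓ ≤ N.hidden + 1) : ∃ v, I.fpZ F x' ℓ = some v := by
  induction ℓ with
  | zero => exact ⟨_, rfl⟩
  | succ ℓ ih =>
    have hℓ' : ℓ ≤ N.hidden := by omega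
    obtain ⟨v, hv⟩ := ih (by omega)
    have hD := fpZ_error hexact (fun ℓ h => (hov ℓ h).bias_repr) hx hℓ' hv
    obtain ⟨y, hy⟩ := fpLayer_exists (I := I) hℓ' (hov ℓ hℓ')
      ((l2_le_add_sub v (N.z x' ℓ)).trans (add_le_add (l2_z_le hx hℓ') hD))
    exact ⟨y, by rw [FPImpl.fpZ, hv]; exact hy⟩

/-- The computed margin deviates from the exact one by at most `marginErr`. -/
theorem abs_fpMargin_sub_margin_le (hexact : I.FPExact F) (hout : ∀ t, N.act N.hidden t = t)
    (hb : ∀ ℓ ≤ N.hidden, ∀ i, F.Representable (N.b ℓ i)) (hx : ‖x' - x‖ ≤ ε)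
    {y : N.Class → ℝ} (hy : I.fpEval F x' = some y) (j i : N.Class) :
    |(y i - y j) - N.margin j i x'| ≤ N.marginErr F x ε j i := by
  obtain ⟨v, hv, hlayer⟩ := Option.bind_eq_some_iff.1 hy
  have hD := fpZ_error hexact hb hx le_rfl hv
  have hr := l2_z_le hx (le_refl N.hidden)
  have hκ := F.kappa_nonneg (N.dim N.hidden)
  obtain ⟨ti, hti, hei⟩ := fpLayer_entry hexact le_rfl (hb _ le_rfl) hlayer i
  obtain ⟨tj, htj, hej⟩ := fpLayer_entry hexact le_rfl (hb _ le_rfl) hlayer j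
  rw [hout] at hti htj
  subst hti htj
  set z₀ := N.z x' N.hidden
  have hm : N.margin j i x' = ((N.W N.hidden).mulVec z₀ i + N.b N.hidden i)
      - ((N.W N.hidden).mulVec z₀ j + N.b N.hidden j) :=
    congrArg₂ (· - ·) (hout _) (hout _)
  rw [hm]
  have hv0 : l2 v ≤ N.radius x ε N.hidden + N.dev F x ε N.hidden :=
    (l2_le_add_sub v z₀).trans (by gcongr)
  have h1 : |∑ k, (N.W N.hidden i k - N.W N.hidden j k) * (v k - z₀ k)| ≤
      l2 (fun k => N.W N.hidden i k - N.W N.hidden j k) * N.dev F x ε N.hidden :=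
    (Finset.abs_sum_le_sum_abs _ _).trans ((sum_abs_mul_le _ _).trans
      (mul_le_mul_of_nonneg_left hD (l2_nonneg _)))
  have h2 : ∑ k, |N.W N.hidden i k * v k| + ∑ k, |N.W N.hidden j k * v k| ≤
      N.absRowSum j i * (N.radius x ε N.hidden + N.dev F x ε N.hidden) := by
    rw [← Finset.sum_add_distrib]
    refine le_trans (le_of_eq ?_) ((sum_abs_mul_le (fun k => |N.W N.hidden i k| + |N.W N.hidden j k|)
      v).trans (mul_le_mul_of_nonneg_left hv0 (l2_nonneg _)))
    refine Finset.sum_congr rfl fun k _ => ?_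
    rw [abs_mul, abs_mul, abs_mul, abs_of_nonneg (a := |_| + |_|) (by positivity), add_mul]
  have h3 := mul_le_mul_of_nonneg_left h2 hκ
  have h4 : ∑ k, (N.W N.hidden i k - N.W N.hidden j k) * (v k - z₀ k) =
      ((N.W N.hidden).mulVec v i - (N.W N.hidden).mulVec z₀ i)
        - ((N.W N.hidden).mulVec v j - (N.W N.hidden).mulVec z₀ j) := by
    simp only [Matrix.mulVec, dotProduct, ← Finset.sum_sub_distrib]
    exact Finset.sum_congr rfl fun k _ => by ring
  rw [h4, abs_le] at h1
  rw [abs_le] at hei hej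
  rw [marginErr, alphaOut, betaOut, abs_le]
  constructor <;> linarith [h1.1, h1.2, hei.1, hei.2, hej.1, hej.2]

end Network

theorem argMax_eq_singleton {m : ℕ} {y : Fin m → ℝ} {i : Fin m} (h : ∀ j, j ≠ i → y i - y j > 0) :
    argMax y = {i} := by
  ext k
  simp only [argMax, Set.mem_ofPred_eq, Set.mem_singleton_iff]
  constructor
  · intro hk
    by_contra hne
    linarith [h k hne, hk i]
  · rintro rfl j
    by_cases hj : j = k
    · rw [hj]
    · linarith [h j hj]

end FPRobust

theorem mainTheorem1 (F : FPRobust.Format) (N : FPRobust.Network) (I : N.FPImpl)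
    (hexact : I.FPExact F)
    (hout : ∀ t : ℝ, N.act N.hidden t = t)
    (x : N.Input) (ε : ℝ) (hε : 0 < ε)
    (istar : N.Class) (histar : istar ∈ FPRobust.argMax (N.eval x))
    -- overflow-freedom conditions at every layer
    (hoverflow : ∀ ℓ ≤ N.hidden, N.OverflowFreeAt F x ε ℓ)
    -- margin Lipschitz constants
    (Lm : N.Class → ℝ) (hLm : ∀ j, j ≠ istar → 0 ≤ Lm j)
    (hLip : ∀ j, j ≠ istar → ∀ x₁ x₂ : N.Input,
      |N.margin j istar x₁ - N.margin j istar x₂| ≤ Lm j * ‖x₁ - x₂‖)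
    -- certification condition, with the outputs `yhat` of the floating-point execution at `x`
    (hcert : ∀ j, j ≠ istar → ∀ yhat, I.fpEval F x = some yhat →
      (yhat istar - yhat j) - Lm j * ε
        - (N.marginErr F x 0 j istar + N.marginErr F x ε j istar) > 0) :
    -- at the centre and on the whole ball, the execution is overflow-free and decides for `istar`
    (∃ yhat, I.fpEval F x = some yhat ∧ FPRobust.argMax yhat = {istar}) ∧
    ∀ x' ∈ Metric.closedBall x ε, ∃ yhat, I.fpEval F x' = some yhat ∧
      (∀ j, j ≠ istar → yhat istar - yhat j > 0) ∧
      FPRobust.argMax yhat = {istar} := by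

  have hb : ∀ ℓ ≤ N.hidden, ∀ i, F.Representable (N.b ℓ i) := fun ℓ h => (hoverflow ℓ h).bias_repr
  have hself : ∀ δ : ℝ, 0 ≤ δ → ‖x - x‖ ≤ δ := fun δ hδ => by simpa using hδ
  obtain ⟨y₀, hy₀⟩ := FPRobust.Network.fpZ_exists hexact hoverflow (hself ε hε.le) le_rfl
  have hball : ∀ x' ∈ Metric.closedBall x ε, ∃ yhat, I.fpEval F x' = some yhat ∧
      (∀ j, j ≠ istar → yhat istar - yhat j > 0) ∧ FPRobust.argMax yhat = {istar} := by
    intro x' hx'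
    rw [mem_closedBall_iff_norm] at hx'
    obtain ⟨y, hy⟩ := FPRobust.Network.fpZ_exists hexact hoverflow hx' le_rfl
    have hpos : ∀ j, j ≠ istar → y istar - y j > 0 := by
      intro j hj
      have h1 := abs_le.1 <|
        FPRobust.Network.abs_fpMargin_sub_margin_le hexact hout hb hx' hy j istar
      have h2 := abs_le.1 <|
        FPRobust.Network.abs_fpMargin_sub_margin_le hexact hout hb (hself 0 le_rfl) hy₀ j istar
      have h3 := abs_le.1 ((hLip j hj x' x).trans (mul_le_mul_of_nonneg_left hx' (hLm j hj)))
      linarith [hcert j hj y₀ hy₀, h1.1, h2.2, h3.1]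
    exact ⟨y, hy, hpos, FPRobust.argMax_eq_singleton hpos⟩
  obtain ⟨y, hy, -, hmax⟩ := hball x (Metric.mem_closedBall_self hε.le)
  exact ⟨⟨y, hy, hmax⟩, hball⟩
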